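/- Let $K/k$ be a finite separable field extension with normal closure $\tilde K/k$, and put $G=\mathrm{Gal}(\tilde K/k)$, $G'=\mathrm{Gal}(\tilde K/K)$. Assume that $K/k$ is almost classically Galois: $G'$ has a normal complement $N$ in $G$ (so $N\trianglelefteq G$, $N\cap G'=1$, $NG'=G$). Assume that $N$ is characteristically simple (nontrivial, with no characteristic subgroups other than $1$ and $N$) and that $G$ is the holomorph of $N$, i.e. $G\cong N\rtimes \mathrm{Aut}(N)$. Regard $N$ as a subgroup of $\mathrm{Perm}(G/G')$ through the left translation action $\lambda:G\to\mathrm{Perm}(G/G')$, and let $$\tilde K[N]^G=\{x\in\tilde K[N] : \sigma(x)=x \text{ for all } \sigma\in G\},\qquad \sigma\Big(\sum_{\tau\in N}a_\tau\tau\Big)=\sum_{\tau\in N}\sigma(a_\tau)\,\lambda(\sigma)\tau\lambda(\sigma)^{-1}.$$ Then $\tilde K[N]^G$ defines a minimal Hopf-Galois structure on $K/k$. That is: the $\tilde K$-Hopf algebra structure of $\tilde K[N]$ induces on $\tilde K[N]^G$ the structure of a finite cocommutative $k$-Hopf algebra $H$; the rule $\big(\sum_\tau a_\tau\tau\big)\cdot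 x=\sum_\tau a_\tau\,(\tau^{-1}G')(x)$ for $x\in K$, where $\tau^{-1}G'\in G/G'$ is the image of the trivial coset under $\tau^{-1}$ and $(gG')(x)=g(x)$, defines a Hopf action $\mu:H\to\mathrm{End}_k(K)$ (making $K$ an $H$-module algebra) for which $K\otimes_k H\to\mathrm{End}_k(K)$, $s\otimes h\mapsto\big(t\mapsto s\,\mu(h)(t)\big)$, is an isomorphism; and $H$ has exactly two $k$-sub-Hopf algebras, with $\dim_k H\neq 1$. -/

import Mathlib

open scoped TensorProduct

namespace HopfGalois

/-! ### Sub-Hopf algebras and (minimal) Hopf-Galois structures -/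

section Hopf

/-- A `k`-sub-Hopf algebra of a `k`-Hopf algebra `H`: a `k`-subalgebra `H'` (containing `1`) with
`Δ(H') ⊆ H' ⊗ H'` (seen inside `H ⊗ H`) and `S(H') ⊆ H'`. -/
structure SubHopfAlgebra (k H : Type*) [Field k] [Ring H] [HopfAlgebra k H] extends
    Subalgebra k H where
  comul_mem : ∀ h ∈ toSubalgebra, Coalgebra.comul (R := k) h ∈
    LinearMap.range (TensorProduct.map toSubalgebra.val.toLinearMap toSubalgebra.val.toLinearMap)
  antipode_mem : ∀ h ∈ toSubalgebra, HopfAlgebra.antipode k h ∈ toSubalgebra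

/-- For a `k`-algebra map `μ : H → End_k(K)`, the map `(1, μ) : K ⊗ H → End_k(K)` sending
`s ⊗ h` to the endomorphism `t ↦ s * μ(h)(t)`. -/
noncomputable def oneTensor {k K H : Type*} [Field k] [Field K] [Algebra k K] [Ring H]
    [Algebra k H] (μ : H →ₐ[k] Module.End k K) : K ⊗[k] H →ₗ[k] Module.End k K :=
  TensorProduct.lift ((LinearMap.mul k (Module.End k K)).compl₁₂
    (Algebra.lmul k K).toLinearMap μ.toLinearMap)

theorem oneTensor_tmul {k K H : Type*} [Field k] [Field K] [Algebra k K] [Ring H]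
    [Algebra k H] (μ : H →ₐ[k] Module.End k K) (s : K) (h : H) (t : K) :
    oneTensor μ (s ⊗ₜ[k] h) t = s * μ h t := by
  simp [oneTensor]

/-- A Hopf-Galois structure on the extension `K/k` given by the `k`-Hopf algebra `H`: `H` is finite
over `k` and cocommutative, and there is a Hopf action `μ : H → End_k(K)` (that is, `K` becomes an
`H`-module algebra) such that `(1, μ) : K ⊗ H → End_k(K)` is bijective. -/
structure HopfGaloisStructure (k K H : Type*) [Field k] [Field K] [Algebra k K] [Ring H]
    [HopfAlgebra k H] where
  /-- the Hopf action -/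
  action : H →ₐ[k] Module.End k K
  finite : Module.Finite k H
  cocomm : Coalgebra.IsCocomm k H
  action_one : ∀ h : H, action h 1 = algebraMap k K (Coalgebra.counit h)
  action_mul : ∀ (h : H) (r : Coalgebra.Repr k h (H × H)) (x y : K),
    action h (x * y) = ∑ i ∈ r.index, action (r.left i) x * action (r.right i) y
  bijective : Function.Bijective (oneTensor action)

/-- A Hopf-Galois structure is minimal if its Hopf algebra has exactly two sub-Hopf algebras;
the case `dim_k H = 1` is excluded. -/
def HopfGaloisStructure.IsMinimal {k K H : Type*} [Field k] [Field K] [Algebra k K] [Ring H]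
    [HopfAlgebra k H] (_ : HopfGaloisStructure k K H) : Prop :=
  Nat.card (SubHopfAlgebra k H) = 2 ∧ Module.finrank k H ≠ 1

end Hopf

/-! ### The algebra of `G`-fixed elements in a group algebra -/

section Descent

variable (k K L : Type*) [Field k] [Field K] [Field L] [Algebra k K] [Algebra k L] [Algebra K L]
  [IsScalarTower k K L]

/-- The subgroup `G' = Gal(L/K)` of `G = Gal(L/k)`. -/
def galSub : Subgroup (L ≃ₐ[k] L) :=
  (IsScalarTower.toAlgHom k K L).fieldRange.fixingSubgroup

/-- The left coset space `G/G'`. -/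
abbrev Cosets : Type _ := (L ≃ₐ[k] L) ⧸ galSub k K L

/-- The left translation action `λ : G → Perm(G/G')`, `λ_g (x G') = g x G'`. -/
abbrev lam : (L ≃ₐ[k] L) →* Equiv.Perm (Cosets k K L) :=
  MulAction.toPermHom (L ≃ₐ[k] L) (Cosets k K L)

variable {k K L}

/-- Evaluation of a coset `g G'` at `x ∈ K`: the element `g(x)` of `L`. -/
def cosetEval (c : Cosets k K L) (x : K) : L :=
  Quotient.liftOn' c (fun g : L ≃ₐ[k] L => g (algebraMap K L x)) (by
    intro a b hab
    have h : a⁻¹ * b ∈ galSub k K L := QuotientGroup.leftRel_apply.mp hab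
    have h2 := (IntermediateField.mem_fixingSubgroup_iff _ _).mp h (algebraMap K L x) ⟨x, rfl⟩
    have h3 : a.symm (b (algebraMap K L x)) = algebraMap K L x := h2
    change a (algebraMap K L x) = b (algebraMap K L x)
    rw [← h3, AlgEquiv.apply_symm_apply, h3])

variable (P : Subgroup (Equiv.Perm (Cosets k K L)))
  (hP : (lam k K L).range ≤ Subgroup.normalizer (P : Set (Equiv.Perm (Cosets k K L))))

/-- For `P ≤ Perm(G/G')` normalized by `λ(G)`: the automorphism `τ ↦ λ(σ) τ λ(σ)⁻¹` of `P`. -/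
def conjAut : (L ≃ₐ[k] L) →* MulAut P :=
  P.normalizerMonoidHom.comp ((Subgroup.inclusion hP).comp (lam k K L).rangeRestrict)

theorem conjAut_coe (σ : L ≃ₐ[k] L) (τ : P) :
    ((conjAut P hP σ τ : P) : Equiv.Perm (Cosets k K L)) =
      lam k K L σ * (τ : Equiv.Perm (Cosets k K L)) * (lam k K L σ)⁻¹ := rfl

/-- The action of `σ ∈ G` on the group algebra `L[P]`:
`∑ a_τ τ ↦ ∑ σ(a_τ) λ(σ) τ λ(σ)⁻¹`. -/
noncomputable def semiAct (σ : L ≃ₐ[k] L) : MonoidAlgebra L P →+* MonoidAlgebra L P :=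
  (MonoidAlgebra.mapDomainRingHom L (conjAut P hP σ).toMonoidHom).comp
    (MonoidAlgebra.mapRingHom P (σ : L ≃+* L).toRingHom)

theorem semiAct_single (σ : L ≃ₐ[k] L) (τ : P) (a : L) :
    semiAct P hP σ (MonoidAlgebra.single τ a) =
      MonoidAlgebra.single (conjAut P hP σ τ) (σ a) := by
  simp [semiAct]

/-- The ring `L[P]^G` of elements of `L[P]` fixed by all `σ ∈ G`. -/
noncomputable def fixedRing : Subring (MonoidAlgebra L P) :=
  ⨅ σ : L ≃ₐ[k] L, (semiAct P hP σ).eqLocus (RingHom.id _)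

theorem mem_fixedRing (x : MonoidAlgebra L P) :
    x ∈ fixedRing P hP ↔ ∀ σ : L ≃ₐ[k] L, semiAct P hP σ x = x := by
  simp only [fixedRing, Subring.mem_iInf]
  rfl

/-- A `k`-Hopf algebra structure on `L[P]^G` is the canonical one if it is induced by the `L`-Hopf
algebra structure of the group algebra `L[P]`: scalars, comultiplication, counit and antipode
are compatible with the inclusion `L[P]^G ⊆ L[P]`. -/
structure IsInduced [HopfAlgebra k (fixedRing P hP)] : Prop where
  algebraMap_coe : ∀ c : k, ((algebraMap k (fixedRing P hP) c : fixedRing P hP) :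
    MonoidAlgebra L P) = algebraMap L (MonoidAlgebra L P) (algebraMap k L c)
  counit_coe : ∀ h : fixedRing P hP, algebraMap k L (Coalgebra.counit h) =
    Coalgebra.counit (R := L) (h : MonoidAlgebra L P)
  comul_coe : ∀ (h : fixedRing P hP)
    (r : Coalgebra.Repr k h (fixedRing P hP × fixedRing P hP)),
    ∑ i ∈ r.index, (r.left i : MonoidAlgebra L P) ⊗ₜ[L] (r.right i : MonoidAlgebra L P) =
      Coalgebra.comul (R := L) (h : MonoidAlgebra L P)
  antipode_coe : ∀ h : fixedRing P hP,
    ((HopfAlgebra.antipode k h : fixedRing P hP) : MonoidAlgebra L P) =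
      HopfAlgebra.antipode L (h : MonoidAlgebra L P)

/-- The Hopf-Galois structure `S` on `K/k` is the one defined by `L[P]^G`: its action is
`(∑ a_τ τ) · x = ∑ a_τ (τ⁻¹ G')(x)`, where `τ⁻¹ G' ∈ G/G'` is the image under `τ⁻¹` of the
trivial coset, evaluated at `x`. -/
def IsDefinedByFixed [HopfAlgebra k (fixedRing P hP)]
    (S : HopfGaloisStructure k K (fixedRing P hP)) : Prop :=
  ∀ (h : fixedRing P hP) (x : K), algebraMap K L (S.action h x) =
    (h : MonoidAlgebra L P).coeff.sum fun τ a =>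
      a * cosetEval ((τ : Equiv.Perm (Cosets k K L))⁻¹ ((1 : L ≃ₐ[k] L) : Cosets k K L)) x

/-- `K/k` has a minimal Hopf-Galois structure defined by `L[P]^G`. -/
def DefinesMinimalStructure : Prop :=
  ∃ _ : HopfAlgebra k (fixedRing P hP), IsInduced P hP ∧
    ∃ S : HopfGaloisStructure k K (fixedRing P hP), IsDefinedByFixed P hP S ∧ S.IsMinimal

variable (K)

/-- The image in `Perm(G/G')` of a normal subgroup of `G` is normalized by `λ(G)`. -/
theorem range_le_normalizer (N : Subgroup (L ≃ₐ[k] L)) [hN : N.Normal] :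
    (lam k K L).range ≤ Subgroup.normalizer
      ((N.map (lam k K L) : Subgroup (Equiv.Perm (Cosets k K L))) :
        Set (Equiv.Perm (Cosets k K L))) := by
  have h := Subgroup.le_normalizer_map (H := N) (lam k K L)
  rw [Subgroup.normalizer_eq_top, ← MonoidHom.range_eq_map] at h
  exact h

end Descent

/-! ### Group theory -/

/-- A group is characteristically simple if it is nontrivial and has no characteristic subgroup
other than `1` and itself. -/
def IsCharacteristicallySimple (N : Type*) [Group N] : Prop :=
  Nontrivial N ∧ ∀ H : Subgroup N, H.Characteristic → H = ⊥ ∨ H = ⊤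

/-- The holomorph `N ⋊ Aut(N)` of a group `N`. -/
abbrev Holomorph (N : Type*) [Group N] : Type _ := N ⋊[MonoidHom.id (MulAut N)] MulAut N

end HopfGalois

/-!
The proof is Galois descent for Hopf algebras followed by an analysis of grouplike elements. Write
`G' = Gal(L/K)` and let `P` be the image of `N` in `Perm(G/G')`.

The semilinear action of `G` on `L[P]` makes `L[P]` the base change of `H = L[P]^G`
(`isBaseChange_of_forall_fixed_iff`). The same holds for tensor powers, which are therefore embedded
in those of `L[P]`; as the structure maps of `L[P]` commute with `G`, they restrict to `H`, and the
Hopf algebra axioms for `H` can be checked in `L[P]` (`HopfDescentDatum.hopfAlgebra`).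

For a coset `c` and `x ∈ K` put `E_c(h)(x) = ∑ a_τ (τ⁻¹c)(x)` (`evalMap`). On fixed elements `h` it
satisfies `E_{gc}(h)(x) = g(E_c(h)(x))`, so at the trivial coset it takes values in `K`, and it turns
products into composites. The resulting map `K ⊗ H → End_k(K)` is injective by Dedekind's independence
of the embeddings `K → L`, and bijective by comparing dimensions (`bijective_oneTensor`).

The `L`-span of a sub-Hopf algebra `S ⊆ H` contains with `∑ a_τ τ` every `a_τ τ`
(`single_coeff_mem_spanOver`), so it is the group algebra of a `G`-stable subgroup of `P`. Here `G'`
acts faithfully on `N` by conjugation because `L` is the normal closure of `K`, and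
`|G'| = |Aut(N)|`, so every automorphism of `N` is a conjugation (`exists_conjNormal_eq`) and
`G`-stable subgroups of `N` are characteristic. Hence the subgroup is trivial, which forces `S = k`, or
it is `P`, which forces `S = H` for dimension reasons.
-/

namespace HopfGalois

/-! ### Galois descent of vector spaces -/

section Descent

variable {k L : Type*} [Field k] [Field L] [Algebra k L]

/-- The orthogonality relation `∑ bᵢ* σ(bᵢ) = δ_{σ,1}` between a basis and its trace dual: expand
`x = ∑ᵢ Tr(bᵢ x) bᵢ*` into automorphisms and compare coefficients by Dedekind independence. -/
theorem sum_traceDual_mul_apply [FiniteDimensional k L] [IsGalois k L] {ι : Type*} [Fintype ι]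
    [DecidableEq ι] [DecidableEq (L ≃ₐ[k] L)] (b : Module.Basis ι k L) (σ : L ≃ₐ[k] L) :
    ∑ i, b.traceDual i * σ (b i) = if σ = 1 then 1 else 0 := by
  have hli := (linearIndependent_toLinearMap k L L).comp
    (fun σ : L ≃ₐ[k] L ↦ (σ : L →ₐ[k] L)) (fun σ τ h ↦ by
      ext x; exact DFunLike.congr_fun h x)
  rw [Fintype.linearIndependent_iff] at hli
  have key := hli (fun σ ↦ (∑ i, b.traceDual i * σ (b i)) - if σ = 1 then 1 else 0) (by
    ext x
    simp only [LinearMap.sum_apply, LinearMap.smul_apply, Function.comp_apply, smul_eq_mul,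
      AlgHom.toLinearMap_apply, LinearMap.zero_apply, sub_mul,
      Finset.sum_sub_distrib, ite_mul, one_mul, zero_mul, Finset.sum_ite_eq', Finset.mem_univ,
      if_true]
    rw [sub_eq_zero]
    change _ = x
    conv_rhs => rw [← b.traceDual.sum_repr x]
    simp_rw [Finset.sum_mul]
    rw [Finset.sum_comm]
    refine Finset.sum_congr rfl fun i _ ↦ ?_
    rw [Module.Basis.traceDual_repr_apply, Algebra.traceForm_apply, Algebra.smul_def,
      trace_eq_sum_automorphisms, Finset.sum_mul]
    refine Finset.sum_congr rfl fun τ _ ↦ ?_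
    rw [map_mul]
    change _ * τ x = _
    ring) σ
  exact sub_eq_zero.mp key

variable {V W : Type*} [AddCommGroup V] [Module k V] [Module L V] [IsScalarTower k L V]
  [AddCommGroup W] [Module k W]

/-- **Galois descent**: if the Galois group of the finite extension `L/k` acts semilinearly on the
`L`-space `V` with fixed space `W`, then `L ⊗[k] W → V` is bijective. With `T v = ∑ σ(v)`, the
inverse is `v ↦ ∑ᵢ bᵢ* ⊗ T(bᵢ v)`. -/
theorem isBaseChange_of_forall_fixed_iff [FiniteDimensional k L] [IsGalois k L]
    {f : W →ₗ[k] V} (hf : Function.Injective f)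
    (act : ∀ σ : L ≃ₐ[k] L, V →ₛₗ[(σ : L →+* L)] V)
    (act_one : ∀ v, act 1 v = v) (act_mul : ∀ σ τ v, act (σ * τ) v = act σ (act τ v))
    (hfix : ∀ v, v ∈ LinearMap.range f ↔ ∀ σ, act σ v = v) : IsBaseChange L f := by
  classical
  have hact : ∀ σ w, act σ (f w) = f w := fun σ w ↦ (hfix _).1 ⟨w, rfl⟩ σ
  let b := Module.Free.chooseBasis k L
  have hrange : ∀ v, ∑ σ, act σ v ∈ LinearMap.range f := fun v ↦ (hfix _).2 fun σ ↦ by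
    rw [map_sum]
    exact Fintype.sum_equiv (Equiv.mulLeft σ) _ _ fun τ ↦ (act_mul σ τ v).symm
  -- the averaging map `v ↦ ∑ σ(v)`, with values in `W`
  choose T hT using hrange
  have hTsmul : ∀ (a : L) (w : W), T (a • f w) = Algebra.trace k L a • w := fun a w ↦ hf <| by
    rw [hT, map_smul, ← algebraMap_smul L (Algebra.trace k L a) (f w),
      trace_eq_sum_automorphisms, Finset.sum_smul]
    exact Finset.sum_congr rfl fun σ _ ↦ by rw [map_smulₛₗ, hact]; rfl
  have hTadd : ∀ v w, T (v + w) = T v + T w := fun v w ↦ hf <| by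
    simp [hT, Finset.sum_add_distrib]
  have hTzero : T 0 = 0 := hf <| by simp [hT]
  let ψ : V → L ⊗[k] W := fun v ↦ ∑ i, b.traceDual i ⊗ₜ[k] T (b i • v)
  have hleft : Function.LeftInverse ψ (f.liftBaseChange L) := fun z ↦ by
    induction z with
    | zero => simp [ψ, hTzero]
    | add x y hx hy =>
      rw [map_add]
      conv_rhs => rw [← hx, ← hy]
      simp [ψ, hTadd, TensorProduct.tmul_add, Finset.sum_add_distrib]
    | tmul a w =>
      simp only [ψ, LinearMap.liftBaseChange_tmul, smul_smul, hTsmul, TensorProduct.tmul_smul,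
        TensorProduct.smul_tmul']
      rw [← TensorProduct.sum_tmul]
      congr 1
      conv_rhs => rw [← b.traceDual.sum_repr a]
      exact Finset.sum_congr rfl fun i _ ↦ by
        rw [Module.Basis.traceDual_repr_apply, Algebra.traceForm_apply, mul_comm]
  have hright : Function.RightInverse ψ (f.liftBaseChange L) := fun v ↦ by
    simp only [ψ, map_sum, LinearMap.liftBaseChange_tmul, hT, Finset.smul_sum]
    rw [Finset.sum_comm]
    have (σ : L ≃ₐ[k] L) : ∑ i, b.traceDual i • act σ (b i • v) =
        (if σ = 1 then 1 else 0 : L) • act σ v := by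
      rw [← sum_traceDual_mul_apply b σ, Finset.sum_smul]
      exact Finset.sum_congr rfl fun i _ ↦ by rw [map_smulₛₗ, smul_smul]; rfl
    simp_rw [this]
    simp [act_one]
  exact .of_equiv (.ofBijective (f.liftBaseChange L) ⟨hleft.injective, hright.surjective⟩)
    fun w ↦ (f.liftBaseChange_tmul L 1 w).trans (one_smul _ _)

theorem injective_of_isBaseChange {f : W →ₗ[k] V} (hf : IsBaseChange L f) :
    Function.Injective f := by
  rw [injective_iff_map_eq_zero]
  intro w hw
  let b := Module.Free.chooseBasis k W
  refine b.repr.injective (Finsupp.ext fun i ↦ (algebraMap k L).injective ?_)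
  rw [← hf.basis_repr_comp_apply b, hw]
  simp

theorem finrank_eq_of_isBaseChange {f : W →ₗ[k] V} (hf : IsBaseChange L f) :
    Module.finrank L V = Module.finrank k W := by
  rw [← hf.equiv.finrank_eq, Module.finrank_baseChange]

theorem eq_top_of_span_image_eq_top [FiniteDimensional k W] {f : W →ₗ[k] V}
    (hf : IsBaseChange L f) {U : Submodule k W}
    (hU : Submodule.span L (f '' U) = ⊤) : U = ⊤ := by
  let g := (f ∘ₗ U.subtype).liftBaseChange L
  have hg : LinearMap.range g = ⊤ := by
    rw [eq_top_iff, ← hU, Submodule.span_le]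
    rintro _ ⟨u, hu, rfl⟩
    exact ⟨1 ⊗ₜ ⟨u, hu⟩, by simp [g]⟩
  have hle := LinearMap.finrank_range_le g
  rw [hg, finrank_top, Module.finrank_baseChange, finrank_eq_of_isBaseChange hf] at hle
  exact Submodule.eq_top_of_finrank_eq (le_antisymm (Submodule.finrank_le _) hle)

/-- Converse to Galois descent: for a semilinear action on a base change `V = L ⊗ W` that fixes `W`
pointwise, every fixed vector lies in `W`, since its coordinates in a basis of `W` are fixed. -/
theorem mem_range_of_forall_fixed [FiniteDimensional k L] [IsGalois k L]
    {f : W →ₗ[k] V} (hf : IsBaseChange L f)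
    (act : ∀ σ : L ≃ₐ[k] L, V →ₛₗ[(σ : L →+* L)] V) (hact : ∀ σ w, act σ (f w) = f w)
    {v : V} (hv : ∀ σ, act σ v = v) : v ∈ LinearMap.range f := by
  let b := Module.Free.chooseBasis k W
  have hcoord : ∀ i, (hf.basis b).repr v i ∈ Set.range (algebraMap k L) := fun i ↦ by
    rw [IsGalois.mem_range_algebraMap_iff_fixed]
    intro σ
    have h : ∀ x, (hf.basis b).repr (act σ x) i = σ ((hf.basis b).repr x i) := fun x ↦ by
      induction (hf.basis b).mem_span x using Submodule.span_induction with
      | zero => simp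
      | add x y _ _ hx hy => simp [hx, hy]
      | smul c x _ hx => rw [map_smulₛₗ]; simp [hx]
      | mem x hx =>
        obtain ⟨j, rfl⟩ := hx
        simp [hf.basis_apply, hact, hf.basis_repr_comp_apply]
    rw [← h, hv]
  choose c hc using hcoord
  rw [← (hf.basis b).linearCombination_repr v, Finsupp.linearCombination_apply]
  refine Submodule.sum_mem _ fun i _ ↦ ⟨c i • b i, ?_⟩
  rw [map_smul]
  change _ = (hf.basis b).repr v i • hf.basis b i
  rw [← hc, hf.basis_apply, algebraMap_smul]

variable {V' W' : Type*} [AddCommGroup V'] [Module k V'] [Module L V'] [IsScalarTower k L V']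
  [AddCommGroup W'] [Module k W']

/-- The `k`-linear map `W ⊗[k] W' → V ⊗[L] V'`, `w ⊗ w' ↦ f w ⊗ f' w'`, into the tensor product
over the larger field. -/
noncomputable def tensorOver (f : W →ₗ[k] V) (f' : W' →ₗ[k] V') : W ⊗[k] W' →ₗ[k] V ⊗[L] V' :=
  TensorProduct.mapOfCompatibleSMul L k k V V' ∘ₗ TensorProduct.map f f'

@[simp]
theorem tensorOver_tmul (f : W →ₗ[k] V) (f' : W' →ₗ[k] V') (w : W) (w' : W') :
    tensorOver (L := L) f f' (w ⊗ₜ w') = f w ⊗ₜ[L] f' w' := rfl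

theorem isBaseChange_tensorOver {f : W →ₗ[k] V} {f' : W' →ₗ[k] V'} (hf : IsBaseChange L f)
    (hf' : IsBaseChange L f') : IsBaseChange L (tensorOver (L := L) f f') := by
  let b := Module.Free.chooseBasis k W
  let b' := Module.Free.chooseBasis k W'
  let e := ((b.tensorProduct b').baseChange L).equiv ((hf.basis b).tensorProduct (hf'.basis b'))
    (Equiv.refl _)
  refine .of_equiv e fun z ↦ ?_
  suffices (e.toLinearMap.restrictScalars k) ∘ₗ TensorProduct.mk k L _ 1 =
      tensorOver (L := L) f f' from LinearMap.congr_fun this z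
  refine (b.tensorProduct b').ext fun i ↦ ?_
  have : e (((b.tensorProduct b').baseChange L) i) = _ := Module.Basis.equiv_apply _ _ _ _
  rw [Module.Basis.baseChange_apply] at this
  rw [Equiv.refl_apply, Module.Basis.tensorProduct_apply', Module.Basis.tensorProduct_apply',
    hf.basis_apply, hf'.basis_apply] at this
  rw [Module.Basis.tensorProduct_apply']
  exact this

end Descent

/-! ### Descent of Hopf algebra structures -/

section HopfDescent

/-- The factorization of a linear map `g` through an injective linear map `j` whose range contains
the values of `g`. -/
noncomputable def liftInj {k M N Q : Type*} [Field k] [AddCommGroup M] [Module k M] [AddCommGroup N]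
    [Module k N] [AddCommGroup Q] [Module k Q] (j : M →ₗ[k] N) (hj : Function.Injective j)
    (g : Q →ₗ[k] N) (hg : ∀ x, g x ∈ LinearMap.range j) : Q →ₗ[k] M :=
  (LinearEquiv.ofInjective j hj).symm.toLinearMap ∘ₗ g.codRestrict _ hg

theorem apply_liftInj {k M N Q : Type*} [Field k] [AddCommGroup M] [Module k M] [AddCommGroup N]
    [Module k N] [AddCommGroup Q] [Module k Q] (j : M →ₗ[k] N) (hj : Function.Injective j)
    (g : Q →ₗ[k] N) (hg : ∀ x, g x ∈ LinearMap.range j) (x : Q) :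
    j (liftInj j hj g hg x) = g x :=
  congr_arg Subtype.val ((LinearEquiv.ofInjective j hj).apply_symm_apply (g.codRestrict _ hg x))

variable {k L A H : Type*} [Field k] [Field L] [Algebra k L] [Ring A] [HopfAlgebra L A]
  [Algebra k A] [IsScalarTower k L A] [Ring H] [Algebra k H]

/-- The conditions under which the Hopf algebra structure of the `L`-Hopf algebra `A` descends along
`ι : H → A` to a `k`-algebra `H`: `A` is the base change of `H`, and the comultiplication, counit and
antipode of `A` map `H` into `H ⊗[k] H`, `k` and `H`. -/
structure HopfDescentDatum (k L : Type*) {A H : Type*} [Field k] [Field L] [Algebra k L] [Ring A]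
    [HopfAlgebra L A] [Algebra k A] [IsScalarTower k L A] [Ring H] [Algebra k H]
    (ι : H →ₐ[k] A) : Prop where
  isBaseChange : IsBaseChange L ι.toLinearMap
  comul_mem : ∀ h, Coalgebra.comul (R := L) (ι h) ∈
    LinearMap.range (tensorOver (L := L) ι.toLinearMap ι.toLinearMap)
  counit_mem : ∀ h, Coalgebra.counit (R := L) (ι h) ∈ LinearMap.range (Algebra.linearMap k L)
  antipode_mem : ∀ h, HopfAlgebra.antipode L (ι h) ∈ LinearMap.range ι.toLinearMap

namespace HopfDescentDatum

variable {ι : H →ₐ[k] A}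

theorem tensorOver_mul (x y : H ⊗[k] H) :
    tensorOver (L := L) ι.toLinearMap ι.toLinearMap (x * y) =
      tensorOver ι.toLinearMap ι.toLinearMap x * tensorOver ι.toLinearMap ι.toLinearMap y := by
  induction x with
  | zero => simp
  | add a b ha hb => simp only [add_mul, map_add, ha, hb]
  | tmul a b =>
    induction y with
    | zero => simp
    | add a b ha hb => simp only [mul_add, map_add, ha, hb]
    | tmul c d => simp

variable (D : HopfDescentDatum k L ι)

theorem injective (D : HopfDescentDatum k L ι) : Function.Injective ι := injective_of_isBaseChange D.isBaseChange

theorem tensorOver_injective (D : HopfDescentDatum k L ι) :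
    Function.Injective (tensorOver (L := L) ι.toLinearMap ι.toLinearMap) :=
  injective_of_isBaseChange (isBaseChange_tensorOver D.isBaseChange D.isBaseChange)

/-- The comultiplication of `H`: the restriction of that of `A`. -/
noncomputable def comul : H →ₗ[k] H ⊗[k] H :=
  liftInj (tensorOver (L := L) ι.toLinearMap ι.toLinearMap) D.tensorOver_injective
    ((Coalgebra.comul (R := L) (A := A)).restrictScalars k ∘ₗ ι.toLinearMap) D.comul_mem

/-- The counit of `H`: the restriction of that of `A`. -/
noncomputable def counit : H →ₗ[k] k :=
  liftInj (Algebra.linearMap k L) (algebraMap k L).injective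
    ((Coalgebra.counit (R := L) (A := A)).restrictScalars k ∘ₗ ι.toLinearMap) D.counit_mem

/-- The antipode of `H`: the restriction of that of `A`. -/
noncomputable def antipode : H →ₗ[k] H :=
  liftInj ι.toLinearMap D.injective
    ((HopfAlgebra.antipode L (A := A)).restrictScalars k ∘ₗ ι.toLinearMap) D.antipode_mem

theorem tensorOver_comul (h : H) :
    tensorOver (L := L) ι.toLinearMap ι.toLinearMap (D.comul h) =
      Coalgebra.comul (R := L) (ι h) := apply_liftInj _ _ _ _ _

theorem algebraMap_counit (h : H) :
    algebraMap k L (D.counit h) = Coalgebra.counit (R := L) (ι h) :=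
  apply_liftInj (Algebra.linearMap k L) (algebraMap k L).injective _ D.counit_mem h

theorem coe_antipode (h : H) : ι (D.antipode h) = HopfAlgebra.antipode L (ι h) :=
  apply_liftInj ι.toLinearMap D.injective _ D.antipode_mem h

/-- The descended coalgebra structure. Each axiom is an equation in a tensor power of `H` over `k`,
which embeds into the tensor power of `A` over `L`, where the axiom is known. -/
@[reducible] noncomputable def coalgebra : Coalgebra k H where
  comul := D.comul
  counit := D.counit
  coassoc := by
    ext h
    apply injective_of_isBaseChange (isBaseChange_tensorOver D.isBaseChange
      (isBaseChange_tensorOver D.isBaseChange D.isBaseChange))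
    have h1 : ∀ x : (H ⊗[k] H) ⊗[k] H,
        tensorOver (L := L) ι.toLinearMap (tensorOver (L := L) ι.toLinearMap ι.toLinearMap)
          (TensorProduct.assoc k H H H x) =
        TensorProduct.assoc L A A A
          (tensorOver (L := L) (tensorOver (L := L) ι.toLinearMap ι.toLinearMap)
            ι.toLinearMap x) := fun x ↦ by
      induction x with
      | zero => simp
      | add a b ha hb => simp only [map_add, ha, hb]
      | tmul a b =>
        induction a with
        | zero => simp
        | add a b ha hb => simp only [map_add, TensorProduct.add_tmul, ha, hb]
        | tmul c d => simp
    have h2 : ∀ x : H ⊗[k] H,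
        tensorOver (L := L) (tensorOver (L := L) ι.toLinearMap ι.toLinearMap) ι.toLinearMap
          (D.comul.rTensor H x) = (Coalgebra.comul (R := L) (A := A)).rTensor A
            (tensorOver ι.toLinearMap ι.toLinearMap x) := fun x ↦ by
      induction x with
      | zero => simp
      | add a b ha hb => simp only [map_add, ha, hb]
      | tmul a b => simp [tensorOver_comul]
    have h3 : ∀ x : H ⊗[k] H,
        tensorOver (L := L) ι.toLinearMap (tensorOver (L := L) ι.toLinearMap ι.toLinearMap)
          (D.comul.lTensor H x) = (Coalgebra.comul (R := L) (A := A)).lTensor A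
            (tensorOver ι.toLinearMap ι.toLinearMap x) := fun x ↦ by
      induction x with
      | zero => simp
      | add a b ha hb => simp only [map_add, ha, hb]
      | tmul a b => simp [tensorOver_comul]
    simp only [LinearMap.comp_apply, LinearEquiv.coe_coe, h1, h2, h3, tensorOver_comul]
    exact Coalgebra.coassoc_apply _
  rTensor_counit_comp_comul := by
    ext h
    apply injective_of_isBaseChange (isBaseChange_tensorOver (IsBaseChange.linearMap k L)
      D.isBaseChange)
    have h2 : ∀ x : H ⊗[k] H,
        tensorOver (L := L) (Algebra.linearMap k L) ι.toLinearMap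
          (D.counit.rTensor H x) = (Coalgebra.counit (R := L) (A := A)).rTensor A
            (tensorOver ι.toLinearMap ι.toLinearMap x) := fun x ↦ by
      induction x with
      | zero => simp
      | add a b ha hb => simp only [map_add, ha, hb]
      | tmul a b => simp [algebraMap_counit]
    simp [h2, tensorOver_comul]
  lTensor_counit_comp_comul := by
    ext h
    apply injective_of_isBaseChange (isBaseChange_tensorOver D.isBaseChange
      (IsBaseChange.linearMap k L))
    have h2 : ∀ x : H ⊗[k] H,
        tensorOver (L := L) ι.toLinearMap (Algebra.linearMap k L)
          (D.counit.lTensor H x) = (Coalgebra.counit (R := L) (A := A)).lTensor A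
            (tensorOver ι.toLinearMap ι.toLinearMap x) := fun x ↦ by
      induction x with
      | zero => simp
      | add a b ha hb => simp only [map_add, ha, hb]
      | tmul a b => simp [algebraMap_counit]
    simp [h2, tensorOver_comul]

/-- The descended bialgebra structure. -/
@[reducible] noncomputable def bialgebra : Bialgebra k H :=
  letI := D.coalgebra
  .mk' k H
    (by
      apply (algebraMap k L).injective
      exact (D.algebraMap_counit 1).trans (by simp))
    (by
      intro a b
      apply (algebraMap k L).injective
      refine (D.algebraMap_counit _).trans ?_
      rw [map_mul, Bialgebra.counit_mul, ← algebraMap_counit D, ← algebraMap_counit D]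
      exact (map_mul (algebraMap k L) _ _).symm)
    (by
      apply D.tensorOver_injective
      refine (D.tensorOver_comul _).trans ?_
      rw [map_one, Bialgebra.comul_one, Algebra.TensorProduct.one_def,
        Algebra.TensorProduct.one_def, tensorOver_tmul]
      simp)
    (by
      intro a b
      apply D.tensorOver_injective
      refine (D.tensorOver_comul _).trans ?_
      rw [map_mul, Bialgebra.comul_mul, tensorOver_mul, ← tensorOver_comul D,
        ← tensorOver_comul D]
      rfl)

/-- The descended Hopf algebra structure. -/
@[reducible] noncomputable def hopfAlgebra : HopfAlgebra k H where
  __ := D.bialgebra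
  antipode := D.antipode
  mul_antipode_rTensor_comul := by
    ext h
    apply D.injective
    have h2 : ∀ x : H ⊗[k] H, ι (LinearMap.mul' k H (D.antipode.rTensor H x)) =
        LinearMap.mul' L A ((HopfAlgebra.antipode L (A := A)).rTensor A
          (tensorOver ι.toLinearMap ι.toLinearMap x)) := fun x ↦ by
      induction x with
      | zero => simp
      | add a b ha hb => simp only [map_add, ha, hb]
      | tmul a b => simp [coe_antipode]
    refine (h2 _).trans ?_
    refine (congrArg _ (congrArg _ (D.tensorOver_comul h))).trans ?_
    rw [HopfAlgebra.mul_antipode_rTensor_comul_apply, ← algebraMap_counit D,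
      ← IsScalarTower.algebraMap_apply]
    exact (ι.commutes _).symm
  mul_antipode_lTensor_comul := by
    ext h
    apply D.injective
    have h2 : ∀ x : H ⊗[k] H, ι (LinearMap.mul' k H (D.antipode.lTensor H x)) =
        LinearMap.mul' L A ((HopfAlgebra.antipode L (A := A)).lTensor A
          (tensorOver ι.toLinearMap ι.toLinearMap x)) := fun x ↦ by
      induction x with
      | zero => simp
      | add a b ha hb => simp only [map_add, ha, hb]
      | tmul a b => simp [coe_antipode]
    refine (h2 _).trans ?_
    refine (congrArg _ (congrArg _ (D.tensorOver_comul h))).trans ?_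
    rw [HopfAlgebra.mul_antipode_lTensor_comul_apply, ← algebraMap_counit D,
      ← IsScalarTower.algebraMap_apply]
    exact (ι.commutes _).symm

theorem isCocomm [Coalgebra.IsCocomm L A] :
    letI := D.hopfAlgebra
    Coalgebra.IsCocomm k H := by
  let := D.hopfAlgebra
  constructor
  ext h
  apply D.tensorOver_injective
  have h2 : ∀ x : H ⊗[k] H, tensorOver (L := L) ι.toLinearMap ι.toLinearMap
      (TensorProduct.comm k H H x) =
      TensorProduct.comm L A A (tensorOver ι.toLinearMap ι.toLinearMap x) := fun x ↦ by
    induction x with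
    | zero => simp
    | add a b ha hb => simp only [map_add, ha, hb]
    | tmul a b => simp
  refine (h2 _).trans ?_
  refine (congrArg _ (D.tensorOver_comul h)).trans ?_
  rw [Coalgebra.comm_comul]
  exact (D.tensorOver_comul h).symm

end HopfDescentDatum
end HopfDescent

/-! ### The Galois group of the normal closure -/

section Group

theorem isGalois_of_isNormalClosure {k K L : Type*} [Field k] [Field K]
    [Field L] [Algebra k K] [Algebra k L] [FiniteDimensional k K] [Algebra.IsSeparable k K]
    [h : IsNormalClosure k K L] : IsGalois k L := by
  have : Normal k L := IsNormalClosure.normal (K := K)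
  have : Algebra.IsSeparable k (⊤ : IntermediateField k L) := by
    rw [← h.adjoin_rootSet]
    have (x : K) : Algebra.IsSeparable k
        (IntermediateField.adjoin k ((minpoly k x).rootSet L)) := by
      rw [IntermediateField.isSeparable_adjoin_iff_isSeparable]
      intro y hy
      have hsep := Algebra.IsSeparable.isSeparable k x
      rw [IsSeparable] at hsep ⊢
      exact hsep.of_dvd (minpoly.dvd _ _ (Polynomial.aeval_eq_zero_of_mem_rootSet hy))
    infer_instance
  have : Algebra.IsSeparable k L := .of_algHom k _ IntermediateField.topEquiv.symm.toAlgHom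
  exact {}

theorem finiteDimensional_of_isNormalClosure {k K L : Type*} [Field k] [Field K]
    [Field L] [Algebra k K] [Algebra k L] [FiniteDimensional k K]
    [h : IsNormalClosure k K L] : FiniteDimensional k L := by
  have e : (IntermediateField.normalClosure k K L) = ⊤ :=
    (Algebra.IsAlgebraic.isNormalClosure_iff.1 h).2
  have : FiniteDimensional k (IntermediateField.normalClosure k K L) := inferInstance
  rw [e] at this
  exact Module.Finite.equiv IntermediateField.topEquiv.toLinearEquiv

variable {k K L : Type*} [Field k] [Field K] [Field L] [Algebra k K] [Algebra k L] [Algebra K L]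
  [IsScalarTower k K L]

theorem mem_galSub_iff (g : L ≃ₐ[k] L) :
    g ∈ galSub k K L ↔ ∀ x : K, g (algebraMap K L x) = algebraMap K L x := by
  rw [galSub, IntermediateField.mem_fixingSubgroup_iff]
  exact ⟨fun h x ↦ h _ ⟨x, rfl⟩, by rintro h _ ⟨x, rfl⟩; exact h x⟩

theorem eq_one_of_forall_apply_eq [FiniteDimensional k K] [h : IsNormalClosure k K L]
    {g : L ≃ₐ[k] L} (hg : ∀ (σ : L ≃ₐ[k] L) (x : K),
      g (σ (algebraMap K L x)) = σ (algebraMap K L x)) : g = 1 := by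
  have : Normal k L := IsNormalClosure.normal (K := K)
  have hfix : (⊤ : IntermediateField k L) ≤
      IntermediateField.fixedField (Subgroup.zpowers g) := by
    rw [← h.adjoin_rootSet]
    refine iSup_le fun x ↦ IntermediateField.adjoin_le_iff.2 fun y hy ↦ ?_
    have hx : minpoly k x = minpoly k (algebraMap K L x) :=
      (minpoly.algebraMap_eq (algebraMap K L).injective x).symm
    obtain ⟨σ, rfl⟩ := minpoly.exists_algEquiv_of_root' (K := k) (x := y) (y := algebraMap K L x)
      (Normal.isIntegral inferInstance _).isAlgebraic
      (by rw [← hx]; exact Polynomial.aeval_eq_zero_of_mem_rootSet hy)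
    rintro ⟨_, n, rfl⟩
    have : g ∈ MulAction.stabilizer (L ≃ₐ[k] L) (σ (algebraMap K L x)) := hg σ x
    exact Subgroup.zpow_mem _ this n
  ext y
  exact hfix (IntermediateField.mem_top (x := y)) ⟨g, Subgroup.mem_zpowers g⟩

/-- Every automorphism of `N` is conjugation by an element of `G`. An element of `G'` centralizing
`N` fixes `n(x)` for all `n ∈ N`, `x ∈ K`, hence all conjugates of `K`, hence `L`; so `G'` embeds in
`Aut(N)`. Since `|G'| = |G| / |N| = |Aut(N)|`, the embedding is onto. Only the order of `G` enters, so
the isomorphism of `G` with the holomorph need not respect `N`. -/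
theorem exists_conjNormal_eq [FiniteDimensional k K] [IsNormalClosure k K L]
    {N : Subgroup (L ≃ₐ[k] L)} [N.Normal] (hcompl : N.IsComplement' (galSub k K L))
    (hhol : Nonempty ((L ≃ₐ[k] L) ≃* Holomorph N)) (φ : MulAut N) :
    ∃ g : L ≃ₐ[k] L, MulAut.conjNormal g = φ := by
  have := finiteDimensional_of_isNormalClosure (k := k) (K := K) (L := L)
  have hfin : Finite (MulAut N) := Finite.of_injective (fun f : MulAut N ↦ (f : N → N))
    DFunLike.coe_injective
  have hcard : Nat.card (MulAut N) = Nat.card (galSub k K L) := by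
    refine Nat.eq_of_mul_eq_mul_left (Nat.card_pos (α := N)) ?_
    rw [hcompl.card_mul_card, Nat.card_congr hhol.some.toEquiv]
    exact SemidirectProduct.card.symm
  let f : galSub k K L →* MulAut N := MulAut.conjNormal.comp (galSub k K L).subtype
  have hf : Function.Injective f := by
    rw [injective_iff_map_eq_one]
    rintro ⟨g, hg⟩ h1
    refine Subtype.ext (eq_one_of_forall_apply_eq (K := K) fun σ x ↦ ?_)
    obtain ⟨⟨n, s⟩, rfl⟩ := hcompl.surjective σ
    have hs := (mem_galSub_iff _).1 s.2 x
    have hgx := (mem_galSub_iff _).1 hg x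
    have hn : g * n * g⁻¹ = n := by
      simpa [f] using congr_arg Subtype.val (DFunLike.congr_fun h1 n)
    have hn' : g * n = n * g := by rwa [mul_inv_eq_iff_eq_mul] at hn
    change g (n.1 (s.1 (algebraMap K L x))) = n.1 (s.1 (algebraMap K L x))
    rw [hs]
    change (g * n.1) _ = _
    rw [hn']
    change n.1 (g _) = _
    rw [hgx]
  obtain ⟨g, hg⟩ := (hf.bijective_of_nat_card_le hcard.le).surjective φ
  exact ⟨g, hg⟩

/-- `G`-stable subgroups of `λ(N)` correspond to characteristic subgroups of `N`. -/
theorem eq_bot_or_eq_top_of_conj_mem [FiniteDimensional k K] [IsNormalClosure k K L]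
    {N : Subgroup (L ≃ₐ[k] L)} [N.Normal] (hcompl : N.IsComplement' (galSub k K L))
    (hchar : IsCharacteristicallySimple N)
    (hhol : Nonempty ((L ≃ₐ[k] L) ≃* Holomorph N)) (M : Subgroup (N.map (lam k K L)))
    (hM : ∀ (σ : L ≃ₐ[k] L), ∀ τ ∈ M, conjAut _ (range_le_normalizer K N) σ τ ∈ M) :
    M = ⊥ ∨ M = ⊤ := by
  let f : N →* N.map (lam k K L) := (lam k K L).subgroupMap N
  have hf : Function.Surjective f := (lam k K L).subgroupMap_surjective N
  have hconj : ∀ (g : L ≃ₐ[k] L) (n : N),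
      f (MulAut.conjNormal g n) = conjAut _ (range_le_normalizer K N) g (f n) := fun g n ↦ by
    apply Subtype.ext
    rw [conjAut_coe]
    change lam k K L _ = _ * lam k K L _ * _
    simp only [MulAut.conjNormal_apply, map_mul, map_inv]
  have hchar' : (M.comap f).Characteristic := by
    rw [Subgroup.characteristic_iff_le_comap]
    intro φ n hn
    obtain ⟨g, rfl⟩ := exists_conjNormal_eq hcompl hhol φ
    change f (MulAut.conjNormal g n) ∈ M
    rw [hconj]
    exact hM g _ hn
  rw [← Subgroup.map_comap_eq_self_of_surjective hf M]
  rcases hchar.2 _ hchar' with h | h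
  · exact .inl (by rw [h, Subgroup.map_bot])
  · exact .inr (by rw [h, Subgroup.map_top_of_surjective f hf])

/-- `λ(N)` acts freely on the trivial coset. -/
theorem injective_inv_apply_one {N : Subgroup (L ≃ₐ[k] L)} (h : Disjoint N (galSub k K L)) :
    Function.Injective fun τ : N.map (lam k K L) ↦
      (τ : Equiv.Perm (Cosets k K L))⁻¹ ((1 : L ≃ₐ[k] L) : Cosets k K L) := by
  rintro ⟨_, n, hn, rfl⟩ ⟨_, m, hm, rfl⟩ hnm
  have hnm' : ((n⁻¹ : L ≃ₐ[k] L) : Cosets k K L) = (m⁻¹ : L ≃ₐ[k] L) := by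
    simpa [← map_inv, MulAction.Quotient.smul_coe] using hnm
  rw [QuotientGroup.eq, inv_inv] at hnm'
  have := Subgroup.disjoint_def.1 h (N.mul_mem hn (N.inv_mem hm)) hnm'
  rw [mul_inv_eq_one] at this
  subst this
  rfl

theorem card_map_lam {N : Subgroup (L ≃ₐ[k] L)} (h : Disjoint N (galSub k K L)) :
    Nat.card (N.map (lam k K L)) = Nat.card N := by
  have hinj : Function.Injective ((lam k K L).subgroupMap N) := by
    rw [injective_iff_map_eq_one]
    intro n hn
    have h1 : (n : L ≃ₐ[k] L) • ((1 : L ≃ₐ[k] L) : Cosets k K L) = (1 : L ≃ₐ[k] L) :=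
      DFunLike.congr_fun (congr_arg Subtype.val hn) ((1 : L ≃ₐ[k] L) : Cosets k K L)
    rw [MulAction.Quotient.smul_coe, eq_comm, QuotientGroup.eq] at h1
    exact Subtype.ext (Subgroup.disjoint_def.1 h n.2 (by simpa using h1))
  exact (Nat.card_congr (Equiv.ofBijective _
    ⟨hinj, (lam k K L).subgroupMap_surjective N⟩)).symm

theorem card_map_lam_eq_finrank [IsGalois k L] {N : Subgroup (L ≃ₐ[k] L)}
    (hcompl : N.IsComplement' (galSub k K L)) :
    Nat.card (N.map (lam k K L)) = Module.finrank k K := by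
  have hF := (IsScalarTower.toAlgHom k K L).fieldRange.finrank_eq_fixingSubgroup_index
  have hK : Module.finrank k (IsScalarTower.toAlgHom k K L).fieldRange = Module.finrank k K :=
    (AlgEquiv.ofInjectiveField (IsScalarTower.toAlgHom k K L)).toLinearEquiv.finrank_eq.symm
  rw [card_map_lam hcompl.disjoint, ← hK, hF]
  exact hcompl.index_eq_card.symm

end Group

/-! ### The Hopf algebra of fixed elements -/

section FixedRing

variable {k K L : Type*} [Field k] [Field K] [Field L] [Algebra k K] [Algebra k L] [Algebra K L]
  [IsScalarTower k K L]
  (P : Subgroup (Equiv.Perm (Cosets k K L)))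
  (hP : (lam k K L).range ≤ Subgroup.normalizer (P : Set (Equiv.Perm (Cosets k K L))))

theorem semiAct_smul (σ : L ≃ₐ[k] L) (c : L) (x : MonoidAlgebra L P) :
    semiAct P hP σ (c • x) = σ c • semiAct P hP σ x := by
  induction x using MonoidAlgebra.induction_linear with
  | zero => simp
  | add x y hx hy => simp only [smul_add, map_add, hx, hy]
  | single τ a => simp [semiAct_single]

theorem semiAct_one (x : MonoidAlgebra L P) : semiAct P hP 1 x = x := by
  induction x using MonoidAlgebra.induction_linear with
  | zero => simp
  | add x y hx hy => simp only [map_add, hx, hy]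
  | single τ a => simp [semiAct_single]

theorem semiAct_mul (σ ρ : L ≃ₐ[k] L) (x : MonoidAlgebra L P) :
    semiAct P hP (σ * ρ) x = semiAct P hP σ (semiAct P hP ρ x) := by
  induction x using MonoidAlgebra.induction_linear with
  | zero => simp
  | add x y hx hy => simp only [map_add, hx, hy]
  | single τ a => simp [semiAct_single]

theorem semiAct_coe (σ : L ≃ₐ[k] L) (h : fixedRing P hP) :
    semiAct P hP σ (h : MonoidAlgebra L P) = h := (mem_fixedRing P hP _).1 h.2 σ

/-- The action of `σ` on `L[P]` as a `σ`-semilinear map. -/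
noncomputable def semiActₛₗ (σ : L ≃ₐ[k] L) :
    MonoidAlgebra L P →ₛₗ[(σ : L →+* L)] MonoidAlgebra L P where
  __ := (semiAct P hP σ).toAddMonoidHom
  map_smul' := semiAct_smul P hP σ

@[simp]
theorem semiActₛₗ_apply (σ : L ≃ₐ[k] L) (x : MonoidAlgebra L P) :
    semiActₛₗ P hP σ x = semiAct P hP σ x := rfl

theorem algebraMap_mem_fixedRing (c : k) :
    algebraMap k (MonoidAlgebra L P) c ∈ fixedRing P hP := by
  rw [mem_fixedRing]
  intro σ
  rw [Algebra.algebraMap_eq_smul_one, ← algebraMap_smul L, semiAct_smul, map_one, σ.commutes]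

/-- The `k`-algebra structure of `L[P]^G`, with scalars `k ⊆ L[P]^G ⊆ L[P]`. -/
noncomputable instance fixedRingAlgebra : Algebra k (fixedRing P hP) :=
  ((algebraMap k (MonoidAlgebra L P)).codRestrict _ (algebraMap_mem_fixedRing P hP)).toAlgebra'
    fun c x ↦ Subtype.ext (Algebra.commutes c (x : MonoidAlgebra L P))

/-- The inclusion `L[P]^G ⊆ L[P]` as a `k`-algebra map. -/
noncomputable def fixedRingVal : fixedRing P hP →ₐ[k] MonoidAlgebra L P where
  __ := (fixedRing P hP).subtype
  commutes' _ := rfl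

@[simp]
theorem fixedRingVal_apply (h : fixedRing P hP) : fixedRingVal P hP h = h := rfl

theorem mem_range_fixedRingVal (x : MonoidAlgebra L P) :
    x ∈ LinearMap.range (fixedRingVal P hP).toLinearMap ↔ ∀ σ : L ≃ₐ[k] L, semiAct P hP σ x = x := by
  rw [← mem_fixedRing]
  exact ⟨by rintro ⟨y, rfl⟩; exact y.2, fun h ↦ ⟨⟨x, h⟩, rfl⟩⟩

theorem map_semiAct_comul (σ : L ≃ₐ[k] L) (x : MonoidAlgebra L P) :
    TensorProduct.map (semiActₛₗ P hP σ) (semiActₛₗ P hP σ) (Coalgebra.comul (R := L) x) =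
      Coalgebra.comul (R := L) (semiAct P hP σ x) := by
  induction x using MonoidAlgebra.induction_linear with
  | zero => simp
  | add x y hx hy => simp only [map_add, hx, hy]
  | single τ a => simp [semiAct_single]

theorem counit_semiAct (σ : L ≃ₐ[k] L) (x : MonoidAlgebra L P) :
    Coalgebra.counit (R := L) (semiAct P hP σ x) = σ (Coalgebra.counit (R := L) x) := by
  induction x using MonoidAlgebra.induction_linear with
  | zero => simp
  | add x y hx hy => simp only [map_add, hx, hy]
  | single τ a => simp [semiAct_single]

theorem antipode_semiAct (σ : L ≃ₐ[k] L) (x : MonoidAlgebra L P) :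
    HopfAlgebra.antipode L (semiAct P hP σ x) = semiAct P hP σ (HopfAlgebra.antipode L x) := by
  induction x using MonoidAlgebra.induction_linear with
  | zero => simp
  | add x y hx hy => simp only [map_add, hx, hy]
  | single τ a => simp [semiAct_single]

variable [FiniteDimensional k L] [IsGalois k L]

theorem isBaseChange_fixedRingVal : IsBaseChange L (fixedRingVal P hP).toLinearMap :=
  isBaseChange_of_forall_fixed_iff Subtype.val_injective (semiActₛₗ P hP) (semiAct_one P hP)
    (semiAct_mul P hP) (mem_range_fixedRingVal P hP)

theorem hopfDescentDatum : HopfDescentDatum k L (fixedRingVal P hP) where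
  isBaseChange := isBaseChange_fixedRingVal P hP
  comul_mem h := by
    refine mem_range_of_forall_fixed (isBaseChange_tensorOver (isBaseChange_fixedRingVal P hP)
      (isBaseChange_fixedRingVal P hP))
      (fun σ ↦ TensorProduct.map (semiActₛₗ P hP σ) (semiActₛₗ P hP σ)) (fun σ w ↦ ?_)
      fun σ ↦ ?_
    · induction w with
      | zero => simp
      | add x y hx hy => simp only [map_add, hx, hy]
      | tmul x y => simp [semiAct_coe]
    · rw [map_semiAct_comul, fixedRingVal_apply, semiAct_coe]
  counit_mem h := by
    refine (IsGalois.mem_range_algebraMap_iff_fixed _).2 fun σ ↦ ?_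
    rw [← counit_semiAct P hP, fixedRingVal_apply, semiAct_coe]
  antipode_mem h := by
    refine (mem_range_fixedRingVal P hP _).2 fun σ ↦ ?_
    rw [← antipode_semiAct, fixedRingVal_apply, semiAct_coe]

/-- The `k`-Hopf algebra structure of `L[P]^G` induced by the `L`-Hopf algebra structure of
`L[P]`. -/
noncomputable instance fixedRingHopfAlgebra : HopfAlgebra k (fixedRing P hP) :=
  (hopfDescentDatum P hP).hopfAlgebra

theorem isInduced : IsInduced P hP := by
  let D := hopfDescentDatum P hP
  refine ⟨fun c ↦ rfl, D.algebraMap_counit, fun h r ↦ ?_, D.coe_antipode⟩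
  refine Eq.trans ?_ (D.tensorOver_comul h)
  refine Eq.trans ?_ (congrArg _ r.eq)
  simp

theorem finrank_fixedRing : Module.finrank k (fixedRing P hP) = Nat.card P := by
  rw [← finrank_eq_of_isBaseChange (isBaseChange_fixedRingVal P hP),
    (MonoidAlgebra.coeffLinearEquiv L).finrank_eq,
    Module.finrank_eq_nat_card_basis (Finsupp.basisSingleOne (R := L) (ι := P))]

end FixedRing

/-! ### The Hopf action on `K` -/

section Action

variable {k K L : Type*} [Field k] [Field K] [Field L] [Algebra k K] [Algebra k L] [Algebra K L]
  [IsScalarTower k K L]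

/-- The restriction to `K` of the elements of a coset in `G/G'`, as a `k`-embedding `K → L`. -/
def cosetHom (c : Cosets k K L) : K →ₐ[k] L where
  toFun := cosetEval c
  map_one' := by induction c using QuotientGroup.induction_on; simp [cosetEval]
  map_mul' x y := by induction c using QuotientGroup.induction_on; simp [cosetEval]
  map_zero' := by induction c using QuotientGroup.induction_on; simp [cosetEval]
  map_add' x y := by induction c using QuotientGroup.induction_on; simp [cosetEval]
  commutes' x := by
    induction c using QuotientGroup.induction_on with | _ g
    change g (algebraMap K L (algebraMap k K x)) = _
    rw [← IsScalarTower.algebraMap_apply, g.commutes]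

@[simp]
theorem cosetHom_apply (c : Cosets k K L) (x : K) : cosetHom c x = cosetEval c x := rfl

@[simp]
theorem cosetEval_map_one (c : Cosets k K L) : cosetEval c (1 : K) = 1 := map_one (cosetHom c)

@[simp]
theorem cosetEval_map_mul (c : Cosets k K L) (x y : K) :
    cosetEval c (x * y) = cosetEval c x * cosetEval c y := map_mul (cosetHom c) x y

theorem cosetEval_smul (g : L ≃ₐ[k] L) (c : Cosets k K L) (x : K) :
    cosetEval (g • c) x = g (cosetEval c x) := by
  induction c using QuotientGroup.induction_on; rfl

theorem cosetHom_injective : Function.Injective (cosetHom (k := k) (K := K) (L := L)) := by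
  intro c d h
  induction c using QuotientGroup.induction_on with | _ a
  induction d using QuotientGroup.induction_on with | _ b
  rw [QuotientGroup.eq, galSub, IntermediateField.mem_fixingSubgroup_iff]
  rintro _ ⟨x, rfl⟩
  have hx : a (algebraMap K L x) = b (algebraMap K L x) := DFunLike.congr_fun h x
  change a.symm (b (algebraMap K L x)) = algebraMap K L x
  rw [← hx, AlgEquiv.symm_apply_apply]

variable (P : Subgroup (Equiv.Perm (Cosets k K L)))
  (hP : (lam k K L).range ≤ Subgroup.normalizer (P : Set (Equiv.Perm (Cosets k K L))))

/-- For a coset `c`, the map sending `∑ a_τ τ ∈ L[P]` to the `k`-linear map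
`x ↦ ∑ a_τ (τ⁻¹ c)(x)`, `K → L`. -/
noncomputable def evalMap (c : Cosets k K L) : MonoidAlgebra L P →ₗ[L] (K →ₗ[k] L) :=
  Finsupp.linearCombination L
      (fun τ : P ↦ (cosetHom ((τ : Equiv.Perm (Cosets k K L))⁻¹ c)).toLinearMap) ∘ₗ
    (MonoidAlgebra.coeffLinearEquiv L).toLinearMap

theorem evalMap_apply (c : Cosets k K L) (a : MonoidAlgebra L P) (x : K) :
    evalMap P c a x =
      a.coeff.sum fun τ a ↦ a * cosetEval ((τ : Equiv.Perm (Cosets k K L))⁻¹ c) x := by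
  simp [evalMap, Finsupp.linearCombination_apply, Finsupp.sum]

@[simp]
theorem evalMap_single (c : Cosets k K L) (τ : P) (a : L) (x : K) :
    evalMap P c (MonoidAlgebra.single τ a) x =
      a * cosetEval ((τ : Equiv.Perm (Cosets k K L))⁻¹ c) x := by
  simp [evalMap_apply]

theorem evalMap_single_mul (c : Cosets k K L) (τ : P) (a : L) (y : MonoidAlgebra L P) (x : K) :
    evalMap P c (MonoidAlgebra.single τ a * y) x =
      a * evalMap P ((τ : Equiv.Perm (Cosets k K L))⁻¹ c) y x := by
  induction y using MonoidAlgebra.induction_linear with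
  | zero => simp
  | add y z hy hz => simp only [mul_add, map_add, LinearMap.add_apply, hy, hz]
  | single ρ b => simp [MonoidAlgebra.single_mul_single, mul_assoc]

theorem evalMap_smul_semiAct (g : L ≃ₐ[k] L) (c : Cosets k K L) (a : MonoidAlgebra L P) (x : K) :
    evalMap P (g • c) (semiAct P hP g a) x = g (evalMap P c a x) := by
  induction a using MonoidAlgebra.induction_linear with
  | zero => simp
  | add y z hy hz => simp only [map_add, LinearMap.add_apply, hy, hz]
  | single ρ b =>
    rw [semiAct_single, evalMap_single, evalMap_single, map_mul, ← cosetEval_smul, conjAut_coe]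
    simp

theorem evalMap_smul_coe (g : L ≃ₐ[k] L) (c : Cosets k K L) (h : fixedRing P hP) (x : K) :
    evalMap P (g • c) h x = g (evalMap P c h x) := by
  rw [← evalMap_smul_semiAct P hP, semiAct_coe]

variable [FiniteDimensional k L] [IsGalois k L]

/-- On `x ∈ K`, a fixed element `h ∈ L[P]^G` gives at the trivial coset an element of `L` fixed by
`G'`, that is, an element of `K`. -/
theorem evalMap_one_mem_range (h : fixedRing P hP) (x : K) :
    evalMap P ((1 : L ≃ₐ[k] L) : Cosets k K L) h x ∈
      LinearMap.range (IsScalarTower.toAlgHom k K L).toLinearMap := by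
  have : evalMap P ((1 : L ≃ₐ[k] L) : Cosets k K L) h x ∈
      (IsScalarTower.toAlgHom k K L).fieldRange := by
    rw [← IsGalois.fixedField_fixingSubgroup (IsScalarTower.toAlgHom k K L).fieldRange]
    rintro ⟨g, hg⟩
    change g _ = _
    have hc : g • ((1 : L ≃ₐ[k] L) : Cosets k K L) = ((1 : L ≃ₐ[k] L) : Cosets k K L) := by
      rw [MulAction.Quotient.smul_coe, smul_eq_mul, mul_one, eq_comm, QuotientGroup.eq, inv_one,
        one_mul]
      exact hg
    rw [← evalMap_smul_coe, hc]
  exact this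

/-- The action of `h ∈ L[P]^G` on `K`: `evalMap` at the trivial coset, with values in `K`. -/
noncomputable def actionMap (h : fixedRing P hP) : Module.End k K :=
  liftInj (IsScalarTower.toAlgHom k K L).toLinearMap (algebraMap K L).injective
    (evalMap P ((1 : L ≃ₐ[k] L) : Cosets k K L) (h : MonoidAlgebra L P))
    (evalMap_one_mem_range P hP h)

theorem algebraMap_actionMap (h : fixedRing P hP) (x : K) :
    algebraMap K L (actionMap P hP h x) = evalMap P ((1 : L ≃ₐ[k] L) : Cosets k K L) h x :=
  apply_liftInj (IsScalarTower.toAlgHom k K L).toLinearMap _ _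
    (evalMap_one_mem_range P hP h) x

theorem cosetEval_actionMap (c : Cosets k K L) (h : fixedRing P hP) (x : K) :
    cosetEval c (actionMap P hP h x) = evalMap P c h x := by
  induction c using QuotientGroup.induction_on with | _ g
  change g (algebraMap K L (actionMap P hP h x)) = _
  rw [algebraMap_actionMap, ← evalMap_smul_coe, MulAction.Quotient.smul_coe, smul_eq_mul, mul_one]

theorem evalMap_mul_coe (c : Cosets k K L) (a : MonoidAlgebra L P) (h : fixedRing P hP) (x : K) :
    evalMap P c (a * h) x = evalMap P c a (actionMap P hP h x) := by
  induction a using MonoidAlgebra.induction_linear with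
  | zero => simp
  | add y z hy hz => simp only [add_mul, map_add, LinearMap.add_apply, hy, hz]
  | single ρ b => rw [evalMap_single_mul, evalMap_single, cosetEval_actionMap]

/-- The action of `L[P]^G` on `K` as an algebra map. -/
noncomputable def actionHom : fixedRing P hP →ₐ[k] Module.End k K where
  toFun := actionMap P hP
  map_one' := by
    ext x
    apply (algebraMap K L).injective
    rw [algebraMap_actionMap, Subring.coe_one, MonoidAlgebra.one_def, evalMap_single]
    simp [cosetEval]
  map_mul' a b := by
    ext x
    apply (algebraMap K L).injective
    rw [algebraMap_actionMap, Subring.coe_mul, evalMap_mul_coe, ← algebraMap_actionMap]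
    rfl
  map_zero' := by
    ext x
    apply (algebraMap K L).injective
    simp [algebraMap_actionMap]
  map_add' a b := by
    ext x
    apply (algebraMap K L).injective
    simp [algebraMap_actionMap]
  commutes' c := by
    ext x
    apply (algebraMap K L).injective
    rw [algebraMap_actionMap]
    change evalMap P _ (algebraMap k (MonoidAlgebra L P) c) x = _
    rw [Algebra.algebraMap_eq_smul_one, ← algebraMap_smul L, map_smul, MonoidAlgebra.one_def,
      LinearMap.smul_apply, evalMap_single, Module.algebraMap_end_apply, Algebra.smul_def c x,
      map_mul, ← IsScalarTower.algebraMap_apply, smul_eq_mul]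
    simp [cosetEval]

@[simp]
theorem actionHom_apply (h : fixedRing P hP) : actionHom P hP h = actionMap P hP h := rfl

/-- The map `K ⊗ H → End_k(K)` is the composite `K ⊗ H ⊆ L ⊗ H ≅ L[P] → Hom_k(K, L)`. -/
theorem algebraMap_oneTensor (z : K ⊗[k] fixedRing P hP) (x : K) :
    algebraMap K L (oneTensor (actionHom P hP) z x) =
      evalMap P ((1 : L ≃ₐ[k] L) : Cosets k K L)
        ((isBaseChange_fixedRingVal P hP).equiv
          ((IsScalarTower.toAlgHom k K L).toLinearMap.rTensor (fixedRing P hP) z)) x := by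
  induction z with
  | zero => simp
  | add a b ha hb => simp only [map_add, LinearMap.add_apply, ha, hb]
  | tmul s h =>
    rw [oneTensor_tmul, map_mul, actionHom_apply, algebraMap_actionMap, LinearMap.rTensor_tmul,
      IsBaseChange.equiv_tmul, map_smul]
    rfl

/-- Injectivity is Dedekind independence of the embeddings `τ⁻¹G' : K → L`, `τ ∈ P`; surjectivity
follows because both sides have dimension `[K : k]²`. -/
theorem bijective_oneTensor [FiniteDimensional k K]
    (hreg : Function.Injective fun τ : P ↦
      (τ : Equiv.Perm (Cosets k K L))⁻¹ ((1 : L ≃ₐ[k] L) : Cosets k K L))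
    (hcard : Nat.card P = Module.finrank k K) :
    Function.Bijective (oneTensor (actionHom P hP)) := by
  have : Finite P := Nat.finite_of_card_ne_zero (hcard ▸ Module.finrank_pos.ne')
  have hfr := finrank_fixedRing P hP
  have : Module.Finite k (fixedRing P hP) :=
    Module.finite_of_finrank_pos (hfr ▸ Nat.card_pos)
  have hinj : Function.Injective (oneTensor (actionHom P hP)) := by
    have hli : LinearIndependent L fun τ : P ↦ (cosetHom ((τ : Equiv.Perm (Cosets k K L))⁻¹
        ((1 : L ≃ₐ[k] L) : Cosets k K L))).toLinearMap :=
      (linearIndependent_toLinearMap k K L).comp _ (cosetHom_injective.comp hreg)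
    have hev : Function.Injective (evalMap P ((1 : L ≃ₐ[k] L) : Cosets k K L)) := by
      rw [evalMap, LinearMap.coe_comp]
      exact hli.finsuppLinearCombination_injective.comp
        (MonoidAlgebra.coeffLinearEquiv L).injective
    have hr : Function.Injective
        ((IsScalarTower.toAlgHom k K L).toLinearMap.rTensor (fixedRing P hP)) :=
      Module.Flat.rTensor_preserves_injective_linearMap _ (algebraMap K L).injective
    intro z w hzw
    refine hr ((isBaseChange_fixedRingVal P hP).equiv.injective (hev ?_))
    ext x
    rw [← algebraMap_oneTensor, ← algebraMap_oneTensor, hzw]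
  refine ⟨hinj, (LinearMap.injective_iff_surjective_of_finrank_eq_finrank ?_).1 hinj⟩
  rw [Module.finrank_tensorProduct, Module.finrank_linearMap, hfr, hcard]

/-- The Hopf-Galois structure of Greither and Pareigis attached to a regular subgroup `P` of
`Perm(G/G')` normalized by `λ(G)`. Regularity is given as freeness at the trivial coset together with
`|P| = [K : k]`. -/
noncomputable def hopfGaloisStructure [FiniteDimensional k K]
    (hreg : Function.Injective fun τ : P ↦
      (τ : Equiv.Perm (Cosets k K L))⁻¹ ((1 : L ≃ₐ[k] L) : Cosets k K L))
    (hcard : Nat.card P = Module.finrank k K) :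
    HopfGaloisStructure k K (fixedRing P hP) where
  action := actionHom P hP
  finite := Module.finite_of_finrank_pos
    (by rw [finrank_fixedRing, hcard]; exact Module.finrank_pos)
  cocomm := (hopfDescentDatum P hP).isCocomm
  action_one := fun h ↦ by
    apply (algebraMap K L).injective
    rw [actionHom_apply, algebraMap_actionMap, ← IsScalarTower.algebraMap_apply]
    refine Eq.trans ?_ ((hopfDescentDatum P hP).algebraMap_counit h).symm
    rw [fixedRingVal_apply]
    induction (h : MonoidAlgebra L P) using MonoidAlgebra.induction_linear with
    | zero => simp
    | add y z hy hz => simp only [map_add, LinearMap.add_apply, hy, hz]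
    | single τ a => simp
  action_mul := fun h r x y ↦ by
    apply (algebraMap K L).injective
    let c : Cosets k K L := ((1 : L ≃ₐ[k] L) : Cosets k K L)
    -- `Φ (a ⊗ b) = (a · x) (b · y)` on `L[P] ⊗ L[P]`
    let Φ : MonoidAlgebra L P ⊗[L] MonoidAlgebra L P →ₗ[L] L :=
      LinearMap.mul' L L ∘ₗ TensorProduct.map
        ((LinearMap.applyₗ' L x).comp (evalMap P c)) ((LinearMap.applyₗ' L y).comp (evalMap P c))
    have hΦ : ∀ a : MonoidAlgebra L P,
        Φ (Coalgebra.comul (R := L) a) = evalMap P c a (x * y) := fun a ↦ by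
      induction a using MonoidAlgebra.induction_linear with
      | zero => simp
      | add y z hy hz => simp only [map_add, LinearMap.add_apply, hy, hz]
      | single τ a =>
        simp [Φ, mul_left_comm]
    rw [actionHom_apply, algebraMap_actionMap, ← hΦ, map_sum]
    refine (congrArg Φ ((hopfDescentDatum P hP).tensorOver_comul h)).symm.trans ?_
    refine (congrArg (Φ ∘ _) r.eq).symm.trans ?_
    simp [Φ, algebraMap_actionMap, c]
  bijective := bijective_oneTensor P hP hreg hcard

theorem isDefinedByFixed [FiniteDimensional k K]
    (hreg : Function.Injective fun τ : P ↦
      (τ : Equiv.Perm (Cosets k K L))⁻¹ ((1 : L ≃ₐ[k] L) : Cosets k K L))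
    (hcard : Nat.card P = Module.finrank k K) :
    IsDefinedByFixed P hP (hopfGaloisStructure P hP hreg hcard) := fun h x ↦
  (algebraMap_actionMap P hP h x).trans (evalMap_apply P _ _ _)

end Action

/-! ### Sub-Hopf algebras and `G`-stable subgroups -/

section SubHopf

theorem SubHopfAlgebra.toSubalgebra_injective {k H : Type*} [Field k] [Ring H] [HopfAlgebra k H] :
    Function.Injective (SubHopfAlgebra.toSubalgebra (k := k) (H := H)) := by
  rintro ⟨S, _, _⟩ ⟨T, _, _⟩ h
  cases h
  rfl

/-- The sub-Hopf algebra `H` of `H`. -/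
def topSubHopfAlgebra (k H : Type*) [Field k] [Ring H] [HopfAlgebra k H] :
    SubHopfAlgebra k H where
  toSubalgebra := ⊤
  comul_mem h _ := by
    have hs : Function.Surjective (⊤ : Subalgebra k H).val.toLinearMap :=
      fun x ↦ ⟨⟨x, Algebra.mem_top⟩, rfl⟩
    exact TensorProduct.map_surjective hs hs _
  antipode_mem _ _ := Algebra.mem_top

/-- The sub-Hopf algebra `k` of `H`. -/
def botSubHopfAlgebra (k H : Type*) [Field k] [Ring H] [HopfAlgebra k H] :
    SubHopfAlgebra k H where
  toSubalgebra := ⊥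
  comul_mem h hh := by
    obtain ⟨c, rfl⟩ := Algebra.mem_bot.1 hh
    refine ⟨algebraMap k _ c, ?_⟩
    rw [Bialgebra.comul_algebraMap, Algebra.TensorProduct.algebraMap_apply,
      Algebra.TensorProduct.algebraMap_apply]
    simp
  antipode_mem h hh := by
    obtain ⟨c, rfl⟩ := Algebra.mem_bot.1 hh
    rw [Algebra.algebraMap_eq_smul_one, map_smul, HopfAlgebra.antipode_one]
    exact Subalgebra.smul_mem _ (Subalgebra.one_mem _) _

theorem card_subHopfAlgebra_eq_two {k H : Type*} [Field k] [Ring H] [HopfAlgebra k H]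
    (h : ∀ S : SubHopfAlgebra k H, S.toSubalgebra = ⊥ ∨ S.toSubalgebra = ⊤)
    (h1 : Module.finrank k H ≠ 1) : Nat.card (SubHopfAlgebra k H) = 2 := by
  rw [Nat.card_eq_two_iff]
  refine ⟨botSubHopfAlgebra k H, topSubHopfAlgebra k H, fun e ↦ h1 ?_, ?_⟩
  · have e' : (⊥ : Subalgebra k H) = ⊤ := congr_arg SubHopfAlgebra.toSubalgebra e
    have : Nontrivial H := (Bialgebra.counit_surjective (R := k) (A := H)).nontrivial
    rw [← (Subalgebra.topEquiv (R := k) (A := H)).toLinearEquiv.finrank_eq, ← e']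
    exact Subalgebra.finrank_bot
  · refine Set.eq_univ_of_forall fun S ↦ ?_
    exact (h S).imp (fun e ↦ SubHopfAlgebra.toSubalgebra_injective e)
      fun e ↦ SubHopfAlgebra.toSubalgebra_injective e

variable {k K L : Type*} [Field k] [Field K] [Field L] [Algebra k K] [Algebra k L] [Algebra K L]
  [IsScalarTower k K L]
  (P : Subgroup (Equiv.Perm (Cosets k K L)))
  (hP : (lam k K L).range ≤ Subgroup.normalizer (P : Set (Equiv.Perm (Cosets k K L))))

/-- The `L`-span in `L[P]` of a `k`-subalgebra of `L[P]^G`. -/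
noncomputable def spanOver (S : Subalgebra k (fixedRing P hP)) :
    Submodule L (MonoidAlgebra L P) :=
  Submodule.span L ((fun h : fixedRing P hP ↦ (h : MonoidAlgebra L P)) '' (S : Set (fixedRing P hP)))

theorem coe_mem_spanOver {S : Subalgebra k (fixedRing P hP)} {h : fixedRing P hP} (hh : h ∈ S) :
    (h : MonoidAlgebra L P) ∈ spanOver P hP S :=
  Submodule.subset_span ⟨h, hh, rfl⟩

theorem one_mem_spanOver (S : Subalgebra k (fixedRing P hP)) : 1 ∈ spanOver P hP S :=
  coe_mem_spanOver P hP (S.one_mem)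

theorem mul_mem_spanOver {S : Subalgebra k (fixedRing P hP)} {x y : MonoidAlgebra L P}
    (hx : x ∈ spanOver P hP S) (hy : y ∈ spanOver P hP S) : x * y ∈ spanOver P hP S := by
  have h := Submodule.mul_mem_mul (M := spanOver P hP S) (N := spanOver P hP S) hx hy
  rw [spanOver, Submodule.span_mul_span] at h
  refine Submodule.span_mono ?_ h
  rintro _ ⟨_, ⟨a, ha, rfl⟩, _, ⟨b, hb, rfl⟩, rfl⟩
  exact ⟨a * b, S.mul_mem ha hb, rfl⟩

theorem semiAct_mem_spanOver {S : Subalgebra k (fixedRing P hP)} (σ : L ≃ₐ[k] L)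
    {x : MonoidAlgebra L P} (hx : x ∈ spanOver P hP S) :
    semiAct P hP σ x ∈ spanOver P hP S := by
  refine (Submodule.span_le (p := (spanOver P hP S).comap (semiActₛₗ P hP σ))).2 ?_ hx
  rintro _ ⟨h, hh, rfl⟩
  change semiAct P hP σ h ∈ spanOver P hP S
  rw [semiAct_coe]
  exact coe_mem_spanOver P hP hh

/-- Extraction of the `τ`-coefficient in the second tensor factor: `x ⊗ y ↦ y_τ x`. -/
noncomputable def coeffRight (τ : P) :
    MonoidAlgebra L P ⊗[L] MonoidAlgebra L P →ₗ[L] MonoidAlgebra L P :=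
  (TensorProduct.rid L _).toLinearMap ∘ₗ LinearMap.lTensor _
    (Finsupp.lapply τ ∘ₗ (MonoidAlgebra.coeffLinearEquiv L).toLinearMap)

@[simp]
theorem coeffRight_tmul (τ : P) (x y : MonoidAlgebra L P) :
    coeffRight P τ (x ⊗ₜ y) = y.coeff τ • x := by
  simp [coeffRight]

theorem coeffRight_comul (τ : P) (x : MonoidAlgebra L P) :
    coeffRight P τ (Coalgebra.comul (R := L) x) = MonoidAlgebra.single τ (x.coeff τ) := by
  classical
  induction x using MonoidAlgebra.induction_linear with
  | zero => simp
  | add x y hx hy => simp [hx, hy]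
  | single ρ a =>
    by_cases h : ρ = τ
    · subst h; simp
    · simp [Finsupp.single_eq_of_ne' h]

variable [FiniteDimensional k L] [IsGalois k L]

/-- The `L`-span of a sub-Hopf algebra is a subcoalgebra, so with `∑ a_τ τ` it contains each `a_τ τ`:
apply `coeffRight` to `∑ a_τ τ ⊗ τ`. -/
theorem single_coeff_mem_spanOver (S : SubHopfAlgebra k (fixedRing P hP)) {h : fixedRing P hP}
    (hh : h ∈ S.toSubalgebra) (τ : P) :
    MonoidAlgebra.single τ ((h : MonoidAlgebra L P).coeff τ) ∈ spanOver P hP S.toSubalgebra := by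
  obtain ⟨z, hz⟩ := S.comul_mem h hh
  have h1 : coeffRight P τ (tensorOver (fixedRingVal P hP).toLinearMap
      (fixedRingVal P hP).toLinearMap (TensorProduct.map S.toSubalgebra.val.toLinearMap
        S.toSubalgebra.val.toLinearMap z)) ∈ spanOver P hP S.toSubalgebra := by
    clear hz
    induction z with
    | zero => simp
    | add x y hx hy => simp only [map_add]; exact Submodule.add_mem _ hx hy
    | tmul x y =>
      simp only [TensorProduct.map_tmul, tensorOver_tmul, coeffRight_tmul]
      exact Submodule.smul_mem _ _ (coe_mem_spanOver P hP x.2)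
  rw [hz] at h1
  rw [← coeffRight_comul, ← fixedRingVal_apply, ← (hopfDescentDatum P hP).tensorOver_comul h]
  exact h1

/-- The subgroup of those elements of `P` that lie in the `L`-span of the sub-Hopf algebra `S`. -/
noncomputable def subHopfSubgroup (S : SubHopfAlgebra k (fixedRing P hP)) : Subgroup P where
  carrier := {τ | MonoidAlgebra.single τ (1 : L) ∈ spanOver P hP S.toSubalgebra}
  one_mem' := one_mem_spanOver P hP S.toSubalgebra
  mul_mem' {a b} ha hb := by
    have := mul_mem_spanOver P hP ha hb
    rwa [MonoidAlgebra.single_mul_single, mul_one] at this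
  inv_mem' {a} ha := by
    have : HopfAlgebra.antipode L (MonoidAlgebra.single a (1 : L)) ∈
        spanOver P hP S.toSubalgebra := by
      refine (Submodule.span_le (p := (spanOver P hP S.toSubalgebra).comap
        (HopfAlgebra.antipode L))).2 ?_ ha
      rintro _ ⟨h, hh, rfl⟩
      change HopfAlgebra.antipode L (fixedRingVal P hP h) ∈ spanOver P hP S.toSubalgebra
      rw [← (hopfDescentDatum P hP).coe_antipode h]
      exact coe_mem_spanOver P hP (S.antipode_mem h hh)
    simpa using this

theorem conjAut_mem_subHopfSubgroup (S : SubHopfAlgebra k (fixedRing P hP)) (σ : L ≃ₐ[k] L)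
    (τ : P) (hτ : τ ∈ subHopfSubgroup P hP S) : conjAut P hP σ τ ∈ subHopfSubgroup P hP S := by
  have := semiAct_mem_spanOver P hP σ hτ
  rwa [semiAct_single, map_one] at this

theorem mem_subHopfSubgroup_of_coeff_ne_zero (S : SubHopfAlgebra k (fixedRing P hP))
    {h : fixedRing P hP} (hh : h ∈ S.toSubalgebra) {τ : P}
    (hτ : (h : MonoidAlgebra L P).coeff τ ≠ 0) : τ ∈ subHopfSubgroup P hP S := by
  have := Submodule.smul_mem _ ((h : MonoidAlgebra L P).coeff τ)⁻¹
    (single_coeff_mem_spanOver P hP S hh τ)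
  rwa [MonoidAlgebra.smul_single, smul_eq_mul, inv_mul_cancel₀ hτ] at this

theorem toSubalgebra_eq_bot {S : SubHopfAlgebra k (fixedRing P hP)}
    (hS : subHopfSubgroup P hP S = ⊥) : S.toSubalgebra = ⊥ := by
  refine eq_bot_iff.2 fun h hh ↦ Algebra.mem_bot.2 ⟨(hopfDescentDatum P hP).counit h, ?_⟩
  have hcoeff : (h : MonoidAlgebra L P) =
      MonoidAlgebra.single 1 ((h : MonoidAlgebra L P).coeff 1) := by
    ext τ
    by_cases hτ : τ = 1
    · subst hτ; simp
    · rw [MonoidAlgebra.coeff_single, Finsupp.single_eq_of_ne hτ]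
      by_contra h0
      have := mem_subHopfSubgroup_of_coeff_ne_zero P hP S hh h0
      rw [hS, Subgroup.mem_bot] at this
      exact hτ this
  apply Subtype.ext
  change algebraMap k (MonoidAlgebra L P) _ = _
  rw [IsScalarTower.algebraMap_apply k L, (hopfDescentDatum P hP).algebraMap_counit h,
    fixedRingVal_apply, hcoeff]
  simp

theorem toSubalgebra_eq_top [Finite P] {S : SubHopfAlgebra k (fixedRing P hP)}
    (hS : subHopfSubgroup P hP S = ⊤) : S.toSubalgebra = ⊤ := by
  have hspan : spanOver P hP S.toSubalgebra = ⊤ := by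
    refine eq_top_iff.2 fun x _ ↦ ?_
    induction x using MonoidAlgebra.induction_linear with
    | zero => exact Submodule.zero_mem _
    | add x y hx hy => exact Submodule.add_mem _ (hx trivial) (hy trivial)
    | single τ a =>
      have hτ : MonoidAlgebra.single τ (1 : L) ∈ spanOver P hP S.toSubalgebra :=
        (hS ▸ Subgroup.mem_top τ : τ ∈ subHopfSubgroup P hP S)
      have := Submodule.smul_mem _ a hτ
      rwa [MonoidAlgebra.smul_single, smul_eq_mul, mul_one] at this
  have hfr := finrank_fixedRing P hP
  have : Module.Finite k (fixedRing P hP) :=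
    Module.finite_of_finrank_pos (hfr ▸ Nat.card_pos)
  exact Algebra.toSubmodule_eq_top.1
    (eq_top_of_span_image_eq_top (isBaseChange_fixedRingVal P hP) hspan)

end SubHopf

end HopfGalois

theorem lemma1 (k K L : Type*) [Field k] [Field K] [Field L] [Algebra k K] [Algebra k L]
    [Algebra K L] [IsScalarTower k K L] [FiniteDimensional k K] [Algebra.IsSeparable k K]
    [IsNormalClosure k K L]
    (N : Subgroup (L ≃ₐ[k] L)) [N.Normal]
    (hcompl : Subgroup.IsComplement' N (HopfGalois.galSub k K L))
    (hchar : HopfGalois.IsCharacteristicallySimple N)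
    (hhol : Nonempty ((L ≃ₐ[k] L) ≃* HopfGalois.Holomorph N)) :
    HopfGalois.DefinesMinimalStructure (N.map (HopfGalois.lam k K L))
      (HopfGalois.range_le_normalizer K N) := by
  have : FiniteDimensional k L := HopfGalois.finiteDimensional_of_isNormalClosure (K := K)
  have : IsGalois k L := HopfGalois.isGalois_of_isNormalClosure (K := K)
  have hreg := HopfGalois.injective_inv_apply_one hcompl.disjoint
  have hcard := HopfGalois.card_map_lam_eq_finrank hcompl
  set P := N.map (HopfGalois.lam k K L)
  set hP := HopfGalois.range_le_normalizer K N
  have hfr := HopfGalois.finrank_fixedRing P hP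
  have hne : Nat.card P ≠ 1 := by
    have := hchar.1
    rw [HopfGalois.card_map_lam hcompl.disjoint]
    exact Finite.one_lt_card.ne'
  refine ⟨inferInstance, HopfGalois.isInduced P hP,
    HopfGalois.hopfGaloisStructure P hP hreg hcard,
    HopfGalois.isDefinedByFixed P hP hreg hcard, ?_, hfr ▸ hne⟩
  refine HopfGalois.card_subHopfAlgebra_eq_two (fun S ↦ ?_) (hfr ▸ hne)
  exact (HopfGalois.eq_bot_or_eq_top_of_conj_mem hcompl hchar hhol _
    (HopfGalois.conjAut_mem_subHopfSubgroup P hP S)).imp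
    (HopfGalois.toSubalgebra_eq_bot P hP) (HopfGalois.toSubalgebra_eq_top P hP)
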